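/- Let $V$ be a set of propositional variables, and consider formulas built from $V$ with the binary connectives $\wedge,\vee,\cdot,\to$, the unary connective $B$ and the constants $0,1$; write $\neg\varphi=\varphi\to 0$. The logic $\mathrm{FL}^B_{ew}$ has the axiom schemas of $\mathrm{FL}_{ew}$, namely $(\varphi\to\psi)\to((\psi\to\gamma)\to(\varphi\to\gamma))$; $(\gamma\to\varphi)\to((\gamma\to\psi)\to(\gamma\to(\varphi\wedge\psi)))$; $(\varphi\wedge\psi)\to\varphi$ and $(\varphi\wedge\psi)\to\psi$; $\varphi\to(\varphi\vee\psi)$ and $\psi\to(\varphi\vee\psi)$; $(\varphi\to\gamma)\to((\psi\to\gamma)\to((\varphi\vee\psi)\to\gamma))$; $(\varphi\cdot\psi)\to(\psi\cdot\varphi)$; $(\varphi\cdot\psi)\to\varphi$; $(\varphi\to(\psi\to\gamma))\to((\varphi\cdot\psi)\to\gamma)$; $((\varphi\cdot\psi)\to\gamma)\to(\varphi\to(\psi\to\gamma))$; $0\to\varphi$ and $\varphi\to 1$; together with the axiom schemas $B\varphi\to\varphi$; $B\varphi\vee\neg B\varphi$; $B(\varphi\vee\neg\varphi)\to(B\varphi\vee\neg\varphi)$;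 $B(\varphi\to\psi)\to(B\varphi\to B\psi)$; and the rules modus ponens (from $\varphi$ and $\varphi\to\psi$ derive $\psi$) and (B) (from $\varphi$ derive $B\varphi$). Write $\Gamma\vdash\varphi$ if $\varphi$ is derivable from the axioms and $\Gamma$ with these rules. A residuated lattice is an algebra $(A;\wedge,\vee,\cdot,\to,0,1)$ such that $(A;\wedge,\vee)$ is a lattice with least element $0$ and greatest element $1$, $(A;\cdot,1)$ is a commutative monoid, and $a\cdot b\le c$ iff $a\le b\to c$ for all $a,b,c\in A$. An $\mathbb{RL}^B$-algebra is a residuated lattice with a unary operation $B$ such that, for all $a,b\in A$ and with $\neg x=x\to 0$: $Ba\le a$; $Ba\vee\neg Ba=1$; and if $b\le a$ and $b\vee\neg b=1$ then $b\le Ba$. An $\mathbf A$-evaluation is a map $e$ from formulas to $A$ that commutes with all connectives and constants. Theorem (finite model property of $\mathrm{FL}^B_{ew}$). Let $\Gamma$ be a finite set of formulas and $\varphi$ a formula. If $\Gamma\nvdash\varphi$, then there are a finite $\mathbb{RL}^B$-algebra $\mathbf A$ and an $\mathbf A$-evaluation $e$ such that $e(\gamma)=1$ for every $\gamma\in\Gamma$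 and $e(\varphi)<1$. -/

import Mathlib

/-- Formulas of the language `∧, ∨, ·, →, B, 0, 1` over a set `V` of propositional variables. -/
inductive BFormula (V : Type*) : Type _ where
  | var : V → BFormula V
  | zero : BFormula V
  | one : BFormula V
  | and : BFormula V → BFormula V → BFormula V
  | or : BFormula V → BFormula V → BFormula V
  | fus : BFormula V → BFormula V → BFormula V
  | imp : BFormula V → BFormula V → BFormula V
  | box : BFormula V → BFormula V

namespace BFormula

/-- Negation `¬ φ := φ → 0`. -/
def neg {V : Type*} (φ : BFormula V) : BFormula V := imp φ zero

/-- Instances, in the language with `B`, of the axiom schemas of `FL_ew`. -/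
inductive FLewAxiom {V : Type*} : BFormula V → Prop where
  | trans (φ ψ χ : BFormula V) :
      FLewAxiom (imp (imp φ ψ) (imp (imp ψ χ) (imp φ χ)))
  | and_intro (φ ψ χ : BFormula V) :
      FLewAxiom (imp (imp χ φ) (imp (imp χ ψ) (imp χ (and φ ψ))))
  | and_left (φ ψ : BFormula V) : FLewAxiom (imp (and φ ψ) φ)
  | and_right (φ ψ : BFormula V) : FLewAxiom (imp (and φ ψ) ψ)
  | or_left (φ ψ : BFormula V) : FLewAxiom (imp φ (or φ ψ))
  | or_right (φ ψ : BFormula V) : FLewAxiom (imp ψ (or φ ψ))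
  | or_elim (φ ψ χ : BFormula V) :
      FLewAxiom (imp (imp φ χ) (imp (imp ψ χ) (imp (or φ ψ) χ)))
  | fus_comm (φ ψ : BFormula V) : FLewAxiom (imp (fus φ ψ) (fus ψ φ))
  | fus_left (φ ψ : BFormula V) : FLewAxiom (imp (fus φ ψ) φ)
  | uncurry (φ ψ χ : BFormula V) :
      FLewAxiom (imp (imp φ (imp ψ χ)) (imp (fus φ ψ) χ))
  | curry (φ ψ χ : BFormula V) :
      FLewAxiom (imp (imp (fus φ ψ) χ) (imp φ (imp ψ χ)))
  | zero_imp (φ : BFormula V) : FLewAxiom (imp zero φ)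
  | imp_one (φ : BFormula V) : FLewAxiom (imp φ one)

/-- Instances of the axiom schemas for `B`. -/
inductive BAxiom {V : Type*} : BFormula V → Prop where
  | b1 (φ : BFormula V) : BAxiom (imp (box φ) φ)
  | b2 (φ : BFormula V) : BAxiom (or (box φ) (neg (box φ)))
  | b3 (φ : BFormula V) :
      BAxiom (imp (box (or φ (neg φ))) (or (box φ) (neg φ)))
  | b4 (φ ψ : BFormula V) :
      BAxiom (imp (box (imp φ ψ)) (imp (box φ) (box ψ)))

/-- Derivability `Γ ⊢ φ` in `FL^B_ew`: the rules are modus ponens and `φ / B φ`, the latter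
applicable to every derived formula. -/
inductive Derivable {V : Type*} (Γ : Set (BFormula V)) : BFormula V → Prop where
  | hyp {φ : BFormula V} : φ ∈ Γ → Derivable Γ φ
  | flew {φ : BFormula V} : FLewAxiom φ → Derivable Γ φ
  | bax {φ : BFormula V} : BAxiom φ → Derivable Γ φ
  | mp {φ ψ : BFormula V} : Derivable Γ φ → Derivable Γ (imp φ ψ) → Derivable Γ ψ
  | nec {φ : BFormula V} : Derivable Γ φ → Derivable Γ (box φ)

end BFormula

/-- Bounded integral commutative residuated lattices. -/
class ResiduatedLattice (A : Type*) extends Lattice A, CommMonoid A, Zero A where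
  /-- The residuum `a → b`. -/
  res : A → A → A
  zero_le' : ∀ a : A, 0 ≤ a
  le_one' : ∀ a : A, a ≤ 1
  mul_le_iff_le_res : ∀ a b c : A, a * b ≤ c ↔ a ≤ res b c

namespace ResiduatedLattice

/-- The negation `¬ a := a → 0`. -/
def rneg {A : Type*} [ResiduatedLattice A] (a : A) : A := res a 0

end ResiduatedLattice

/-- `RL^B`-algebras: residuated lattices with a unary operation `B` such that `B a` is the greatest
Boolean element below `a`, where `b` is Boolean iff `b ∨ ¬ b = 1`. -/
class RLBAlgebra (A : Type*) extends ResiduatedLattice A where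
  /-- The operation `B`. -/
  bop : A → A
  bop_le : ∀ a : A, bop a ≤ a
  bop_sup_rneg : ∀ a : A, bop a ⊔ ResiduatedLattice.rneg (bop a) = 1
  le_bop : ∀ a b : A, b ≤ a → b ⊔ ResiduatedLattice.rneg b = 1 → b ≤ bop a

namespace BFormula

/-- The evaluation in an `RL^B`-algebra determined by the values `v` of the variables. -/
def eval {V A : Type*} [RLBAlgebra A] (v : V → A) : BFormula V → A
  | var p => v p
  | zero => 0
  | one => 1
  | and φ ψ => eval v φ ⊓ eval v ψ
  | or φ ψ => eval v φ ⊔ eval v ψ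
  | fus φ ψ => eval v φ * eval v ψ
  | imp φ ψ => ResiduatedLattice.res (eval v φ) (eval v ψ)
  | box φ => RLBAlgebra.bop (eval v φ)

end BFormula

/-! By Zorn's lemma, Γ extends to a set Δ maximal among those not deriving φ. The deduction theorem
(`Derivable.deduction`, with `B` guarding the discharged premise) then shows that the Lindenbaum
algebra of Δ has no complemented elements besides 0 and 1. In such an algebra `B` is forced: it
fixes 1 and sends everything else to 0. It remains to map the finitely many values `g i` of the
relevant subformulas into a finite residuated lattice with the same property.

That lattice consists of sets of exponent vectors of monomials in the `g i`, closed with respect to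
the ideals of monomials below `c`. Dickson's lemma leaves finitely many closed sets, and
`wordsBelow` respects every operation whose arguments and value lie among the `g i`. To avoid new
complemented elements, `c` runs over all finite joins of the `g i`, not only over the `g i`
themselves. If `X ⊔ ¬X = 1`, testing against the join over the complement of `τ` puts a power of the
product over `τ` into `X` or `¬X`, unless that join is 1. By `sup_prod_pow_eq_one` these powers join
to 1, so they split 1 as `u ⊔ v` with `u * v = 0`. Thus `u` is complemented, hence 0 or 1, and `X`
follows suit (`ClosedIdeal.eq_zero_or_eq_one`). -/

namespace ResiduatedLattice

/-! ### Powers and joins in residuated lattices -/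

section Basic

variable {A : Type*} [ResiduatedLattice A]

instance : BoundedOrder A where
  top := 1
  le_top := le_one'
  bot := 0
  bot_le := zero_le'

theorem one_le_iff {a : A} : 1 ≤ a ↔ a = 1 := top_le_iff

theorem le_zero_iff {a : A} : a ≤ 0 ↔ a = 0 := le_bot_iff

instance : IsOrderedMonoid A where
  mul_le_mul_left _ _ h _ :=
    (mul_le_iff_le_res _ _ _).2 (h.trans ((mul_le_iff_le_res _ _ _).1 le_rfl))

theorem mul_le_left (a b : A) : a * b ≤ a := mul_le_of_le_one_right' (le_one' b)

theorem mul_le_right (a b : A) : a * b ≤ b := mul_le_of_le_one_left' (le_one' a)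

theorem sup_mul_le_iff {a b c d : A} : (a ⊔ b) * c ≤ d ↔ a * c ≤ d ∧ b * c ≤ d := by
  simp only [mul_le_iff_le_res, sup_le_iff]

theorem finset_sup_mul_le_iff {ι : Type*} {s : Finset ι} {f : ι → A} {c d : A} :
    s.sup f * c ≤ d ↔ ∀ i ∈ s, f i * c ≤ d := by
  simp only [mul_le_iff_le_res, Finset.sup_le_iff]

theorem pow_antitone (a : A) {m n : ℕ} (h : m ≤ n) : a ^ n ≤ a ^ m :=
  pow_le_pow_right_of_le_one' (le_one' a) h

/-- Pigeonhole: a monomial of degree `m + n` in `a` and `b` has at least `m` factors `a` or at least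
`n` factors `b`. The double induction peels off one factor at a time. -/
theorem sup_pow_add_le (a b : A) (m n : ℕ) : (a ⊔ b) ^ (m + n) ≤ a ^ m ⊔ b ^ n := by
  induction m generalizing n with
  | zero => rw [pow_zero]; exact (le_one' _).trans le_sup_left
  | succ m ihm =>
    induction n with
    | zero => rw [pow_zero]; exact (le_one' _).trans le_sup_right
    | succ n ihn =>
      have e : (a ⊔ b) ^ (m + 1 + (n + 1)) = (a ⊔ b) * (a ⊔ b) ^ (m + 1 + n) := by
        rw [← pow_succ']; rfl
      have key {x y : A} : y * x ≤ (a ^ (m + 1) ⊔ b ^ (n + 1)) ↔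
        x * y ≤ (a ^ (m + 1) ⊔ b ^ (n + 1)) := by rw [mul_comm]
      rw [e, sup_mul_le_iff]
      constructor
      · have h := ihm (n + 1)
        rw [show m + (n + 1) = m + 1 + n by omega] at h
        refine (mul_le_mul_right h a).trans ?_
        rw [key, sup_mul_le_iff]
        exact ⟨by rw [← pow_succ]; exact le_sup_left, (mul_le_left _ _).trans le_sup_right⟩
      · refine (mul_le_mul_right ihn b).trans ?_
        rw [key, sup_mul_le_iff]
        exact ⟨(mul_le_left _ _).trans le_sup_left, by rw [← pow_succ]; exact le_sup_right⟩

/-- The elements some power of which is brought below `r` by some power of `q` are closed under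
finite joins. -/
theorem exists_pow_mul_sup_pow_le {ι : Type*} (q r : A) (s : Finset ι) (f : ι → A)
    (h : ∀ i ∈ s, ∃ m, q ^ m * f i ^ m ≤ r) : ∃ m, q ^ m * s.sup f ^ m ≤ r := by
  classical
  induction s using Finset.induction_on with
  | empty => exact ⟨1, by simpa using (mul_le_right q ⊥).trans bot_le⟩
  | insert i s _ ih =>
    obtain ⟨m, hm⟩ := h i (Finset.mem_insert_self i s)
    obtain ⟨n, hn⟩ := ih fun j hj => h j (Finset.mem_insert_of_mem hj)
    refine ⟨m + n, ?_⟩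
    rw [Finset.sup_insert]
    refine (mul_le_mul_right (sup_pow_add_le _ _ m n) _).trans ?_
    rw [mul_comm, sup_mul_le_iff]
    constructor
    · rw [mul_comm]
      exact (mul_le_mul_left (pow_antitone q (Nat.le_add_right m n)) _).trans hm
    · rw [mul_comm]
      exact (mul_le_mul_left (pow_antitone q (Nat.le_add_left n m)) _).trans hn

variable {ι : Type*} [Fintype ι] [DecidableEq ι] (g : ι → A)

/-- The products over the sets of indices whose complement does not join to `1` cover `1`,
even after raising them to a power. -/
theorem sup_prod_pow_eq_one (N : ℕ) (s : Finset (Finset ι))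
    (hs : ∀ τ : Finset ι, τᶜ.sup g ≠ 1 → τ ∈ s) :
    s.sup (fun τ => (∏ i ∈ τ, g i) ^ N) = 1 := by
  classical
  set r := s.sup (fun τ => (∏ i ∈ τ, g i) ^ N) with hr
  by_contra hne
  have hfin : {τ : Finset ι | ∀ m, ¬ (∏ i ∈ τ, g i) ^ m ≤ r}.Finite := Set.toFinite _
  -- Take `τ` maximal with no power of its product below `r`; the empty set qualifies because its
  -- product is 1 and `r ≠ 1`.
  obtain ⟨τ, hτ⟩ := hfin.exists_maximal ⟨∅, fun m h => hne (one_le_iff.1 (by simpa using h))⟩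
  have hτm : ∀ m, ¬ (∏ i ∈ τ, g i) ^ m ≤ r := hτ.prop
  -- By maximality each index outside `τ` brings some power below `r`. Joining over all of them
  -- replaces the extra factor by a power of 1, so a power of the product over `τ` itself is below
  -- `r`.
  have hc : τᶜ.sup g = 1 → False := by
    intro h1
    obtain ⟨m, hm⟩ := exists_pow_mul_sup_pow_le (∏ i ∈ τ, g i) r τᶜ g (by
      intro i hi
      by_contra! hcon
      have hmem : insert i τ ∈ {τ : Finset ι | ∀ m, ¬ (∏ i ∈ τ, g i) ^ m ≤ r} := by
        intro m hm
        refine hcon m ?_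
        rwa [Finset.prod_insert (Finset.mem_compl.1 hi), mul_pow, mul_comm] at hm
      exact Finset.mem_compl.1 hi (hτ.le_of_ge hmem (Finset.subset_insert i τ)
        (Finset.mem_insert_self i τ)))
    rw [h1, one_pow, mul_one] at hm
    exact hτm m hm
  exact hτm N (Finset.le_sup (f := fun τ => (∏ i ∈ τ, g i) ^ N) (hs τ hc))

end Basic

end ResiduatedLattice

/-! ### The algebra of closed sets of a family of monoid ideals -/

section Closed

variable {ι κ : Type*} (U : κ → UpperSet (ι → ℕ))

/-- The closure operator on sets of exponent vectors determined by the translates of the ideals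
`U k`. -/
def idealClosure (X : Set (ι → ℕ)) : Set (ι → ℕ) :=
  {x | ∀ y k, (∀ z ∈ X, z + y ∈ U k) → x + y ∈ U k}

/-- Sets of exponent vectors that are intersections of translates of the ideals `U k`. -/
def ClosedIdeal : Type _ := {X : Set (ι → ℕ) // idealClosure U X ⊆ X}

variable {U}

theorem subset_idealClosure (X : Set (ι → ℕ)) : X ⊆ idealClosure U X :=
  fun x hx _ _ h => h x hx

theorem idealClosure_mono {X Y : Set (ι → ℕ)} (h : X ⊆ Y) :
    idealClosure U X ⊆ idealClosure U Y :=
  fun _ hx y k hy => hx y k fun z hz => hy z (h hz)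

theorem idealClosure_idem (X : Set (ι → ℕ)) :
    idealClosure U (idealClosure U X) ⊆ idealClosure U X :=
  fun _ hx y k h => hx y k fun _ hz => hz y k h

namespace ClosedIdeal

instance : SetLike (ClosedIdeal U) (ι → ℕ) where
  coe := Subtype.val
  coe_injective := Subtype.val_injective

instance : PartialOrder (ClosedIdeal U) := PartialOrder.lift _ (SetLike.coe_injective)

theorem mem_of_forall (X : ClosedIdeal U) {x : ι → ℕ}
    (h : ∀ y k, (∀ z ∈ X, z + y ∈ U k) → x + y ∈ U k) : x ∈ X := X.2 h

theorem mem_of_le (X : ClosedIdeal U) {x y : ι → ℕ} (hx : x ∈ X) (h : x ≤ y) : y ∈ X :=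
  X.mem_of_forall fun z k hz => (U k).upper (add_le_add_left h z) (hz x hx)

variable (U) in
/-- The closed set generated by a set. -/
def gen (X : Set (ι → ℕ)) : ClosedIdeal U := ⟨idealClosure U X, idealClosure_idem X⟩

theorem gen_le {X : Set (ι → ℕ)} {Y : ClosedIdeal U} : gen U X ≤ Y ↔ ∀ x ∈ X, x ∈ Y :=
  ⟨fun h _ hx => h (subset_idealClosure X hx), fun h _ hx => Y.2 (idealClosure_mono h hx)⟩

open Pointwise in
/-- The product of two closed sets is generated by the sums of their elements. -/
def prod (X Y : ClosedIdeal U) : ClosedIdeal U := gen U ((X : Set (ι → ℕ)) + (Y : Set (ι → ℕ)))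

theorem prod_le {X Y Z : ClosedIdeal U} : prod X Y ≤ Z ↔ ∀ x ∈ X, ∀ y ∈ Y, x + y ∈ Z := by
  rw [prod, gen_le]
  exact Set.forall_mem_image2 (p := fun z => z ∈ Z)

/-- The residuum of closed sets. -/
def residual (X Y : ClosedIdeal U) : ClosedIdeal U :=
  ⟨{z | ∀ x ∈ X, z + x ∈ Y}, fun z hz x hx => Y.mem_of_forall fun y k h => by
    rw [add_assoc]
    refine hz (x + y) k fun w hw => ?_
    rw [← add_assoc]
    exact h _ (hw x hx)⟩

theorem prod_le_iff_le_residual {X Y Z : ClosedIdeal U} :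
    prod X Y ≤ Z ↔ X ≤ residual Y Z := prod_le

theorem prod_comm (X Y : ClosedIdeal U) : prod X Y = prod Y X := by
  refine eq_of_forall_ge_iff fun Z => ?_
  rw [prod_le, prod_le]
  exact ⟨fun h x hx y hy => add_comm y x ▸ h y hy x hx,
    fun h x hx y hy => add_comm y x ▸ h y hy x hx⟩

theorem prod_assoc (X Y Z : ClosedIdeal U) : prod (prod X Y) Z = prod X (prod Y Z) := by
  -- Products are compared through their upper bounds, which avoids computing with closures.
  refine eq_of_forall_ge_iff fun T => ?_
  have h1 : prod (prod X Y) Z ≤ T ↔ ∀ x ∈ X, ∀ y ∈ Y, ∀ z ∈ Z, x + y + z ∈ T := by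
    rw [prod_le_iff_le_residual, prod_le]; rfl
  have h2 : prod X (prod Y Z) ≤ T ↔ ∀ y ∈ Y, ∀ z ∈ Z, ∀ x ∈ X, y + z + x ∈ T := by
    rw [prod_comm, prod_le_iff_le_residual, prod_le]; rfl
  rw [h1, h2]
  exact ⟨fun h y hy z hz x hx => by rw [add_comm, ← add_assoc]; exact h x hx y hy z hz,
    fun h x hx y hy z hz => by rw [add_assoc, add_comm]; exact h y hy z hz x hx⟩

instance : Lattice (ClosedIdeal U) where
  sup X Y := gen U ((X : Set (ι → ℕ)) ∪ (Y : Set (ι → ℕ)))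
  le_sup_left _ _ _ hx := subset_idealClosure _ (Or.inl hx)
  le_sup_right _ _ _ hx := subset_idealClosure _ (Or.inr hx)
  sup_le _ _ _ h1 h2 := gen_le.2 fun _ hx => hx.elim (fun h => h1 h) (fun h => h2 h)
  inf X Y := ⟨(X : Set (ι → ℕ)) ∩ (Y : Set (ι → ℕ)), fun _ hx =>
    ⟨X.2 (idealClosure_mono Set.inter_subset_left hx),
      Y.2 (idealClosure_mono Set.inter_subset_right hx)⟩⟩
  inf_le_left _ _ _ hx := hx.1
  inf_le_right _ _ _ hx := hx.2
  le_inf _ _ _ h1 h2 _ hx := ⟨h1 hx, h2 hx⟩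

instance : ResiduatedLattice (ClosedIdeal U) where
  mul := prod
  one := ⟨Set.univ, fun _ _ => trivial⟩
  zero := gen U ∅
  mul_assoc := prod_assoc
  mul_comm := prod_comm
  one_mul X := by
    refine le_antisymm (prod_le.2 fun x _ y hy => X.mem_of_le hy (le_add_of_nonneg_left bot_le)) ?_
    intro x hx
    refine subset_idealClosure _ ⟨0, trivial, x, hx, zero_add x⟩
  mul_one X := by
    refine le_antisymm (prod_le.2 fun x hx y _ => X.mem_of_le hx (le_add_of_nonneg_right bot_le)) ?_
    intro x hx
    refine subset_idealClosure _ ⟨x, hx, 0, trivial, add_zero x⟩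
  res := residual
  zero_le' _ := gen_le.2 fun _ hx => hx.elim
  le_one' _ _ _ := trivial
  mul_le_iff_le_res _ _ _ := prod_le_iff_le_residual

theorem mem_inf {X Y : ClosedIdeal U} {x : ι → ℕ} : x ∈ X ⊓ Y ↔ x ∈ X ∧ x ∈ Y := Iff.rfl

theorem mem_sup {X Y : ClosedIdeal U} {x : ι → ℕ} :
    x ∈ X ⊔ Y ↔ ∀ y k, (∀ z, z ∈ X ∨ z ∈ Y → z + y ∈ U k) → x + y ∈ U k := Iff.rfl

theorem mem_one (x : ι → ℕ) : x ∈ (1 : ClosedIdeal U) := trivial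

theorem mem_zero {x : ι → ℕ} : x ∈ (0 : ClosedIdeal U) ↔ ∀ y k, x + y ∈ U k :=
  ⟨fun h y k => h y k fun _ hz => hz.elim, fun h y k _ => h y k⟩

theorem mul_le {X Y Z : ClosedIdeal U} : X * Y ≤ Z ↔ ∀ x ∈ X, ∀ y ∈ Y, x + y ∈ Z := prod_le

theorem mem_mul_of_mem {X Y : ClosedIdeal U} {x y : ι → ℕ} (hx : x ∈ X) (hy : y ∈ Y) :
    x + y ∈ X * Y := mul_le.1 le_rfl x hx y hy

theorem mem_res {X Y : ClosedIdeal U} {z : ι → ℕ} :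
    z ∈ ResiduatedLattice.res X Y ↔ ∀ x ∈ X, z + x ∈ Y := Iff.rfl

theorem eq_one_iff {X : ClosedIdeal U} : X = 1 ↔ (0 : ι → ℕ) ∈ X :=
  ⟨fun h => h ▸ mem_one 0, fun h => le_antisymm (ResiduatedLattice.le_one' X)
    fun _ _ => X.mem_of_le h bot_le⟩

/-- Dickson's lemma: only a bounded part of a translation vector matters to an ideal. -/
theorem exists_inf_add_mem_iff [Finite ι] (S : UpperSet (ι → ℕ)) :
    ∃ N : ι → ℕ, ∀ x y, x + y ∈ S ↔ x + y ⊓ N ∈ S := by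
  have hfin : {x | Minimal (· ∈ S) x}.Finite :=
    WellQuasiOrderedLE.finite_of_isAntichain (setOfPred_minimal_antichain _)
  obtain ⟨N, hN⟩ := hfin.bddAbove
  refine ⟨N, fun x y => ⟨fun h => ?_, fun h => S.upper (add_le_add_right inf_le_left x) h⟩⟩
  obtain ⟨m, hm, hmin⟩ := exists_minimal_le_of_wellFoundedLT (· ∈ S) _ h
  refine S.upper (fun i => ?_) hmin.prop
  have h1 : m i ≤ x i + y i := hm i
  have h2 : m i ≤ N i := hN hmin i
  change m i ≤ x i + min (y i) (N i)
  omega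

/-- A closed set is determined by the translates of the `U k` containing it, and translation vectors
may be truncated at `N k`, leaving finitely many tests. -/
theorem finite [Finite ι] [Finite κ] : Finite (ClosedIdeal U) := by
  classical
  have := Fintype.ofFinite ι
  choose N hN using fun k => exists_inf_add_mem_iff (U k)
  have : ∀ k, Finite (Set.Iic (N k)) := fun k => (Set.finite_Iic (N k)).to_subtype
  let F : ClosedIdeal U → Set (Σ k, Set.Iic (N k)) :=
    fun X => {p | ∀ z ∈ X, z + p.2.1 ∈ U p.1}
  refine Finite.of_injective F fun X Y h => ?_
  have key : ∀ X Y : ClosedIdeal U, F Y ⊆ F X → X ≤ Y := fun X Y h x hx =>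
    Y.mem_of_forall fun y k hy => by
      have := @h ⟨k, y ⊓ N k, Set.mem_Iic.2 inf_le_right⟩ fun z hz => (hN k z y).1 (hy z hz)
      exact (hN k x y).2 (this x hx)
  exact le_antisymm (key X Y h.ge) (key Y X h.le)

end ClosedIdeal

end Closed

/-! ### The finite algebra of a finite family of elements of a residuated lattice -/

section Word

open ResiduatedLattice

variable {A ι : Type*} [ResiduatedLattice A] [Fintype ι] (g : ι → A)

/-- The product of the `g i` with exponents `x`. -/
def word (x : ι → ℕ) : A := ∏ i, g i ^ x i

theorem word_zero : word g 0 = 1 := by simp [word]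

theorem word_add (x y : ι → ℕ) : word g (x + y) = word g x * word g y := by
  simp [word, pow_add, Finset.prod_mul_distrib]

theorem word_antitone : Antitone (word g) := fun _ _ h =>
  Finset.prod_le_prod' fun i _ => pow_antitone (g i) (h i)

theorem word_single [DecidableEq ι] (i : ι) : word g (Pi.single i 1) = g i := by
  rw [word, Finset.prod_eq_single i]
  · simp
  · intro j _ hj
    simp [hj]
  · simp

theorem word_le {x : ι → ℕ} {i : ι} (h : x i ≠ 0) : word g x ≤ g i := by
  classical
  rw [← word_single g i]
  refine word_antitone g fun j => ?_
  by_cases hj : j = i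
  · subst hj; simpa using Nat.one_le_iff_ne_zero.2 h
  · simp [hj]

/-- The exponent vector of the `N`-th power of the product over `τ`. -/
def powVec [DecidableEq ι] (N : ℕ) (τ : Finset ι) : ι → ℕ := fun i => if i ∈ τ then N else 0

theorem word_powVec [DecidableEq ι] (N : ℕ) (τ : Finset ι) :
    word g (powVec N τ) = (∏ i ∈ τ, g i) ^ N := by
  simp only [word, powVec, pow_ite, pow_zero, Finset.prod_ite_mem, Finset.univ_inter,
    Finset.prod_pow]

/-- The ideal of exponent vectors of words below the join over a set of indices. -/
def wordIdeal (τ : Finset ι) : UpperSet (ι → ℕ) where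
  carrier := {x | word g x ≤ τ.sup g}
  upper' _ _ h hx := (word_antitone g h).trans hx

theorem mem_wordIdeal {τ : Finset ι} {x : ι → ℕ} :
    x ∈ wordIdeal g τ ↔ word g x ≤ τ.sup g := Iff.rfl

/-- The closed set generated by the words below `a`. -/
def wordsBelow (a : A) : ClosedIdeal (wordIdeal g) :=
  ClosedIdeal.gen _ {x | word g x ≤ a}

variable {g}

theorem word_mem_zero {x : ι → ℕ} (hx : x ∈ (0 : ClosedIdeal (wordIdeal g))) :
    word g x = 0 := by
  have := ClosedIdeal.mem_zero.1 hx 0 ∅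
  rw [mem_wordIdeal, add_zero, Finset.sup_empty] at this
  exact le_bot_iff.1 this

/-- For `a = g i` the ideal of the singleton `{i}` is the set of words below `a`, so the closure
adds nothing. -/
theorem mem_wordsBelow {a : A} (ha : a ∈ Set.range g) {x : ι → ℕ} :
    x ∈ wordsBelow g a ↔ word g x ≤ a := by
  obtain ⟨i, rfl⟩ := ha
  refine ⟨fun h => ?_, fun h => subset_idealClosure _ h⟩
  have := h 0 {i} fun z hz => by rw [mem_wordIdeal, add_zero, Finset.sup_singleton]; exact hz
  rwa [mem_wordIdeal, add_zero, Finset.sup_singleton] at this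

theorem wordsBelow_eq_one_iff {a : A} (ha : a ∈ Set.range g) :
    wordsBelow g a = 1 ↔ a = 1 := by
  rw [ClosedIdeal.eq_one_iff, mem_wordsBelow ha, word_zero, one_le_iff]

theorem wordsBelow_one : wordsBelow g 1 = 1 :=
  ClosedIdeal.eq_one_iff.2 (subset_idealClosure _ (le_one' _))

theorem wordsBelow_zero : wordsBelow g 0 = 0 := by
  refine le_antisymm (ClosedIdeal.gen_le.2 fun x hx => ClosedIdeal.mem_zero.2 fun y k => ?_)
    (zero_le' _)
  rw [mem_wordIdeal, word_add]
  exact (mul_le_left _ _).trans (le_trans hx (zero_le' _))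

theorem wordsBelow_inf {a b : A} (ha : a ∈ Set.range g) (hb : b ∈ Set.range g)
    (hab : a ⊓ b ∈ Set.range g) : wordsBelow g (a ⊓ b) = wordsBelow g a ⊓ wordsBelow g b := by
  refine SetLike.ext fun x => ?_
  rw [ClosedIdeal.mem_inf, mem_wordsBelow ha, mem_wordsBelow hb, mem_wordsBelow hab, le_inf_iff]

theorem wordsBelow_sup {a b : A} (ha : a ∈ Set.range g) (hb : b ∈ Set.range g)
    (hab : a ⊔ b ∈ Set.range g) : wordsBelow g (a ⊔ b) = wordsBelow g a ⊔ wordsBelow g b := by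
  classical
  refine le_antisymm (fun x hx => ClosedIdeal.mem_sup.2 fun y k h => ?_) (sup_le ?_ ?_)
  · replace hx := (mem_wordsBelow hab).1 hx
    rw [mem_wordIdeal, word_add]
    refine (mul_le_mul_left hx _).trans (sup_mul_le_iff.2 ⟨?_, ?_⟩)
    · obtain ⟨i, rfl⟩ := ha
      rw [← word_single g i, ← word_add]
      exact h _ (Or.inl ((mem_wordsBelow ⟨i, rfl⟩).2 (word_single g i).le))
    · obtain ⟨i, rfl⟩ := hb
      rw [← word_single g i, ← word_add]
      exact h _ (Or.inr ((mem_wordsBelow ⟨i, rfl⟩).2 (word_single g i).le))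
  · exact fun x hx => (mem_wordsBelow hab).2 (((mem_wordsBelow ha).1 hx).trans le_sup_left)
  · exact fun x hx => (mem_wordsBelow hab).2 (((mem_wordsBelow hb).1 hx).trans le_sup_right)

theorem wordsBelow_mul {a b : A} (ha : a ∈ Set.range g) (hb : b ∈ Set.range g)
    (hab : a * b ∈ Set.range g) : wordsBelow g (a * b) = wordsBelow g a * wordsBelow g b := by
  classical
  refine le_antisymm (fun x hx => ?_) (ClosedIdeal.mul_le.2 fun x hx y hy => ?_)
  · refine ClosedIdeal.mem_of_forall _ fun y k h => ?_
    replace hx := (mem_wordsBelow hab).1 hx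
    obtain ⟨i, rfl⟩ := ha
    obtain ⟨j, rfl⟩ := hb
    have := h _ (ClosedIdeal.mem_mul_of_mem
      ((mem_wordsBelow ⟨i, rfl⟩).2 (word_single g i).le)
      ((mem_wordsBelow ⟨j, rfl⟩).2 (word_single g j).le))
    rw [mem_wordIdeal, word_add, word_add, word_single, word_single] at this
    rw [mem_wordIdeal, word_add]
    exact (mul_le_mul_left hx _).trans this
  · rw [mem_wordsBelow hab, word_add]
    exact mul_le_mul' ((mem_wordsBelow ha).1 hx) ((mem_wordsBelow hb).1 hy)

theorem wordsBelow_res {a b : A} (ha : a ∈ Set.range g) (hb : b ∈ Set.range g)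
    (hab : res a b ∈ Set.range g) :
    wordsBelow g (res a b) = res (wordsBelow g a) (wordsBelow g b) := by
  classical
  refine SetLike.ext fun x => ?_
  rw [mem_wordsBelow hab, ← mul_le_iff_le_res, ClosedIdeal.mem_res]
  constructor
  · intro h y hy
    rw [mem_wordsBelow hb, word_add]
    exact (mul_le_mul_right ((mem_wordsBelow ha).1 hy) _).trans h
  · intro h
    obtain ⟨i, rfl⟩ := ha
    have := h _ ((mem_wordsBelow ⟨i, rfl⟩).2 (word_single g i).le)
    rwa [mem_wordsBelow hb, word_add, word_single] at this

/-- If the join of some words is `1` and their exponent vectors lie in a closed set, then that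
closed set is the unit. -/
theorem ClosedIdeal.eq_one_of_sup {X : ClosedIdeal (wordIdeal g)} {α : Type*} (s : Finset α)
    (f : α → ι → ℕ) (hf : ∀ a ∈ s, f a ∈ X) (hs : s.sup (fun a => word g (f a)) = 1) : X = 1 := by
  refine ClosedIdeal.eq_one_iff.2 (X.mem_of_forall fun y k h => ?_)
  rw [mem_wordIdeal, word_add, word_zero, ← hs, finset_sup_mul_le_iff]
  intro a ha
  rw [← word_add]
  exact h _ (hf a ha)

/-- If the only complemented elements of `A` are `0` and `1`, the same holds for the algebra of
closed sets. -/
theorem ClosedIdeal.eq_zero_or_eq_one (hA : ∀ a : A, a ⊔ rneg a = 1 → a = 0 ∨ a = 1)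
    (X : ClosedIdeal (wordIdeal g)) (hX : X ⊔ rneg X = 1) : X = 0 ∨ X = 1 := by
  classical
  set Y := rneg X with hY
  have hXY : ∀ x ∈ X, ∀ y ∈ Y, word g x * word g y = 0 := by
    intro x hx y hy
    rw [← word_add, add_comm]
    exact word_mem_zero (ClosedIdeal.mem_res.1 hy x hx)
  let T : Finset (Finset ι) := Finset.univ.filter fun τ => τᶜ.sup g ≠ 1
  -- Otherwise no vector of `X` or `Y` is supported in `τ`, so all their words lie below the join
  -- over `τᶜ`. Since `X ⊔ Y = 1`, this forces that join to be 1.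
  have hT : ∀ τ ∈ T, ∃ N, powVec N τ ∈ X ∨ powVec N τ ∈ Y := by
    intro τ hτ
    have hτ : τᶜ.sup g ≠ 1 := (Finset.mem_filter.1 hτ).2
    by_contra! hcon
    refine hτ (one_le_iff.1 ?_)
    have h0 : (0 : ι → ℕ) + 0 ∈ wordIdeal g τᶜ := by
      refine ClosedIdeal.mem_sup.1 (ClosedIdeal.eq_one_iff.1 hX) 0 τᶜ fun z hz => ?_
      rw [add_zero, mem_wordIdeal]
      have hle : ¬ ∀ i, i ∉ τ → z i = 0 := by
        intro hsupp
        -- The total degree of `z` serves as a bound on each of its exponents.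
        have hzle : z ≤ powVec (∑ i, z i) τ := by
          intro i
          by_cases hi : i ∈ τ
          · simpa [powVec, hi] using Finset.single_le_sum (fun j _ => Nat.zero_le (z j))
              (Finset.mem_univ i)
          · simp [hsupp i hi]
        rcases hz with hz | hz
        · exact (hcon _).1 (X.mem_of_le hz hzle)
        · exact (hcon _).2 (Y.mem_of_le hz hzle)
      push Not at hle
      obtain ⟨i, hi, hzi⟩ := hle
      exact (word_le g hzi).trans (Finset.le_sup (Finset.mem_compl.2 hi))
    rwa [add_zero, mem_wordIdeal, word_zero] at h0
  choose! n hn using hT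
  -- One exponent works for all `τ`, because closed sets are upward closed.
  set N := T.sup n with hN
  have hmono : ∀ τ ∈ T, powVec (n τ) τ ≤ powVec N τ := by
    intro τ hτ i
    by_cases hi : i ∈ τ
    · simpa [powVec, hi] using Finset.le_sup (f := n) hτ
    · simp [powVec, hi]
  have hmem : ∀ τ ∈ T, powVec N τ ∈ X ∨ powVec N τ ∈ Y := fun τ hτ =>
    (hn τ hτ).imp (fun h => X.mem_of_le h (hmono τ hτ)) (fun h => Y.mem_of_le h (hmono τ hτ))
  let T₁ := T.filter fun τ => powVec N τ ∈ X
  let T₂ := T.filter fun τ => powVec N τ ∈ Y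
  have hT₁ : ∀ τ ∈ T₁, powVec N τ ∈ X := fun τ hτ => (Finset.mem_filter.1 hτ).2
  have hT₂ : ∀ τ ∈ T₂, powVec N τ ∈ Y := fun τ hτ => (Finset.mem_filter.1 hτ).2
  set u := T₁.sup fun τ => word g (powVec N τ) with hu
  set v := T₂.sup fun τ => word g (powVec N τ) with hv
  have huv : u ⊔ v = 1 := by
    rw [hu, hv, ← Finset.sup_union, ← Finset.filter_or, Finset.filter_true_of_mem hmem]
    simp only [word_powVec]
    exact sup_prod_pow_eq_one g N T fun τ h => Finset.mem_filter.2 ⟨Finset.mem_univ _, h⟩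
  have hvu : v ≤ rneg u := by
    rw [rneg, ← mul_le_iff_le_res, hv, finset_sup_mul_le_iff]
    intro σ hσ
    rw [mul_comm, hu, finset_sup_mul_le_iff]
    exact fun τ hτ => (hXY _ (hT₁ τ hτ) _ (hT₂ σ hσ)).le
  have huB : u ⊔ rneg u = 1 := one_le_iff.1 (huv ▸ sup_le_sup_left hvu u)
  rcases hA u huB with h | h
  · left
    have hv1 : v = 1 := by
      rw [← huv, h]; exact (bot_sup_eq v).symm
    have hY1 : Y = 1 := ClosedIdeal.eq_one_of_sup T₂ _ hT₂ hv1
    refine ResiduatedLattice.le_zero_iff.1 fun x hx => ?_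
    have := ClosedIdeal.mem_res.1 (ClosedIdeal.eq_one_iff.1 hY1) x hx
    rwa [zero_add] at this
  · exact Or.inr (ClosedIdeal.eq_one_of_sup T₁ _ hT₁ h)

end Word

/-! ### Transfer of evaluations to the finite algebra -/

open Classical in
/-- A residuated lattice whose only complemented elements are `0` and `1`, with the
operation sending `1` to `1` and everything else to `0`. -/
noncomputable abbrev RLBAlgebra.ofIndecomposable {D : Type*} [ResiduatedLattice D]
    (hD : ∀ a : D, a ⊔ ResiduatedLattice.rneg a = 1 → a = 0 ∨ a = 1) : RLBAlgebra D where
  bop a := if a = 1 then 1 else 0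
  bop_le a := by
    split_ifs with h
    · exact h.ge
    · exact ResiduatedLattice.zero_le' a
  bop_sup_rneg a := by
    split_ifs with h
    · exact top_sup_eq _
    · refine ResiduatedLattice.one_le_iff.1 (le_sup_of_le_right ?_)
      exact (ResiduatedLattice.mul_le_iff_le_res _ _ _).1 (ResiduatedLattice.mul_le_right _ _)
  le_bop a b hb h := by
    rcases hD b h with rfl | rfl
    · exact ResiduatedLattice.zero_le' _
    · rw [if_pos (ResiduatedLattice.one_le_iff.1 hb)]

namespace BFormula

/-- The subformulas of a formula. -/
def subformulas {V : Type*} : BFormula V → Set (BFormula V)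
  | var p => {var p}
  | zero => {zero}
  | one => {one}
  | and φ ψ => insert (and φ ψ) (subformulas φ ∪ subformulas ψ)
  | or φ ψ => insert (or φ ψ) (subformulas φ ∪ subformulas ψ)
  | fus φ ψ => insert (fus φ ψ) (subformulas φ ∪ subformulas ψ)
  | imp φ ψ => insert (imp φ ψ) (subformulas φ ∪ subformulas ψ)
  | box φ => insert (box φ) (subformulas φ)

theorem subformulas_finite {V : Type*} (φ : BFormula V) : φ.subformulas.Finite := by
  induction φ with
  | var | zero | one => exact Set.finite_singleton _
  | and _ _ h1 h2 | or _ _ h1 h2 | fus _ _ h1 h2 | imp _ _ h1 h2 => exact (h1.union h2).insert _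
  | box _ h => exact h.insert _

theorem self_mem_subformulas {V : Type*} (φ : BFormula V) : φ ∈ φ.subformulas := by
  cases φ <;> simp [subformulas]

open ResiduatedLattice in
-- `B a` is always complemented, hence 0 or 1, and it lies below `a`.
theorem bop_eq_of_indecomposable {A : Type*} [RLBAlgebra A]
    (hA : ∀ a : A, a ⊔ rneg a = 1 → a = 0 ∨ a = 1) (a : A) [Decidable (a = 1)] :
    RLBAlgebra.bop a = if a = 1 then 1 else 0 := by
  split_ifs with h
  · subst h
    exact one_le_iff.1 (RLBAlgebra.le_bop 1 1 le_rfl (top_sup_eq _))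
  · refine (hA _ (RLBAlgebra.bop_sup_rneg a)).resolve_right fun h1 => h ?_
    exact one_le_iff.1 (h1 ▸ RLBAlgebra.bop_le a)

open ResiduatedLattice in
/-- For every evaluation in an `RL^B`-algebra with trivial Boolean elements, some evaluation in a
finite algebra sends the same members of a given finite set of formulas to `1`. -/
theorem exists_finite_eval_eq_one_iff {V A : Type*} [RLBAlgebra A]
    (hA : ∀ a : A, a ⊔ rneg a = 1 → a = 0 ∨ a = 1) (v : V → A) (S : Set (BFormula V))
    (hS : S.Finite) :
    ∃ (D : Type) (_ : RLBAlgebra D) (_ : Finite D) (w : V → D),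
      ∀ ψ ∈ S, eval w ψ = 1 ↔ eval v ψ = 1 := by
  classical
  have hfin : (eval v '' ⋃ ψ ∈ S, ψ.subformulas).Finite :=
    (hS.biUnion fun ψ _ => ψ.subformulas_finite).image _
  -- Indexing by `Fin n` makes the algebra of closed sets live in `Type`, whatever the universe of
  -- `A`.
  obtain ⟨n, g, -, hg⟩ := hfin.fin_param
  have hD := ClosedIdeal.eq_zero_or_eq_one (g := g) hA
  let inst : RLBAlgebra (ClosedIdeal (wordIdeal g)) := RLBAlgebra.ofIndecomposable hD
  refine ⟨ClosedIdeal (wordIdeal g), inst, ClosedIdeal.finite, fun p => wordsBelow g (v p), ?_⟩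
  have key : ∀ ψ : BFormula V, (∀ χ ∈ ψ.subformulas, eval v χ ∈ Set.range g) →
      eval (fun p => wordsBelow g (v p)) ψ = wordsBelow g (eval v ψ) := by
    intro ψ hψ
    induction ψ with
    | var p => rfl
    | zero => exact wordsBelow_zero.symm
    | one => exact wordsBelow_one.symm
    | and φ ψ h1 h2 =>
      have i1 := fun χ hχ => hψ χ (Or.inr (Or.inl hχ))
      have i2 := fun χ hχ => hψ χ (Or.inr (Or.inr hχ))
      rw [eval, eval, h1 i1, h2 i2]
      exact (wordsBelow_inf (i1 _ φ.self_mem_subformulas) (i2 _ ψ.self_mem_subformulas)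
        (hψ _ (self_mem_subformulas _))).symm
    | or φ ψ h1 h2 =>
      have i1 := fun χ hχ => hψ χ (Or.inr (Or.inl hχ))
      have i2 := fun χ hχ => hψ χ (Or.inr (Or.inr hχ))
      rw [eval, eval, h1 i1, h2 i2]
      exact (wordsBelow_sup (i1 _ φ.self_mem_subformulas) (i2 _ ψ.self_mem_subformulas)
        (hψ _ (self_mem_subformulas _))).symm
    | fus φ ψ h1 h2 =>
      have i1 := fun χ hχ => hψ χ (Or.inr (Or.inl hχ))
      have i2 := fun χ hχ => hψ χ (Or.inr (Or.inr hχ))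
      rw [eval, eval, h1 i1, h2 i2]
      exact (wordsBelow_mul (i1 _ φ.self_mem_subformulas) (i2 _ ψ.self_mem_subformulas)
        (hψ _ (self_mem_subformulas _))).symm
    | imp φ ψ h1 h2 =>
      have i1 := fun χ hχ => hψ χ (Or.inr (Or.inl hχ))
      have i2 := fun χ hχ => hψ χ (Or.inr (Or.inr hχ))
      rw [eval, eval, h1 i1, h2 i2]
      exact (wordsBelow_res (i1 _ φ.self_mem_subformulas) (i2 _ ψ.self_mem_subformulas)
        (hψ _ (self_mem_subformulas _))).symm
    | box φ h1 =>
      have i1 := fun χ hχ => hψ χ (Or.inr hχ)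
      rw [eval, eval, h1 i1, bop_eq_of_indecomposable hA]
      change (if wordsBelow g (eval v φ) = 1 then (1 : ClosedIdeal (wordIdeal g)) else 0) = _
      rw [wordsBelow_eq_one_iff (i1 _ φ.self_mem_subformulas)]
      split_ifs
      · exact wordsBelow_one.symm
      · exact wordsBelow_zero.symm
  intro ψ hψ
  have hsub : ∀ χ ∈ ψ.subformulas, eval v χ ∈ Set.range g := fun χ hχ =>
    hg ▸ Set.mem_image_of_mem _ (Set.mem_biUnion hψ hχ)
  rw [key ψ hsub]
  exact wordsBelow_eq_one_iff (hsub ψ ψ.self_mem_subformulas)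

end BFormula

/-! ### The Lindenbaum algebra -/

namespace BFormula

variable {V : Type*} {Δ : Set (BFormula V)}

/-! ### Derived rules and the deduction theorem -/

namespace Derivable

theorem imp_trans {φ ψ χ : BFormula V} (h1 : Derivable Δ (imp φ ψ)) (h2 : Derivable Δ (imp ψ χ)) :
    Derivable Δ (imp φ χ) := mp h2 (mp h1 (flew (.trans φ ψ χ)))

theorem curry {φ ψ χ : BFormula V} (h : Derivable Δ (imp (fus φ ψ) χ)) :
    Derivable Δ (imp φ (imp ψ χ)) := mp h (flew (.curry φ ψ χ))

theorem uncurry {φ ψ χ : BFormula V} (h : Derivable Δ (imp φ (imp ψ χ))) :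
    Derivable Δ (imp (fus φ ψ) χ) := mp h (flew (.uncurry φ ψ χ))

theorem exchange {φ ψ χ : BFormula V} (h : Derivable Δ (imp φ (imp ψ χ))) :
    Derivable Δ (imp ψ (imp φ χ)) := curry (imp_trans (flew (.fus_comm ψ φ)) (uncurry h))

theorem weaken {φ : BFormula V} (ψ : BFormula V) (h : Derivable Δ φ) : Derivable Δ (imp ψ φ) :=
  mp h (curry (flew (.fus_left φ ψ)))

theorem imp_refl (φ : BFormula V) : Derivable Δ (imp φ φ) :=
  -- The theorem `φ → 1` serves as a dummy premise: weakening and exchange give `(φ → 1) → (φ → φ)`.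
  mp (flew (.imp_one φ)) (exchange (curry (flew (.fus_left φ (imp φ one)))))

theorem one_intro : Derivable Δ (one : BFormula V) :=
  mp (imp_refl one) (flew (.imp_one (imp one one)))

theorem fus_mono {φ φ' ψ ψ' : BFormula V} (h1 : Derivable Δ (imp φ φ'))
    (h2 : Derivable Δ (imp ψ ψ')) : Derivable Δ (imp (fus φ ψ) (fus φ' ψ')) :=
  uncurry (imp_trans h1 (exchange (imp_trans h2 (exchange (curry (imp_refl _))))))

theorem imp_mono {φ φ' ψ ψ' : BFormula V} (h1 : Derivable Δ (imp φ' φ))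
    (h2 : Derivable Δ (imp ψ ψ')) : Derivable Δ (imp (imp φ ψ) (imp φ' ψ')) :=
  curry (imp_trans (fus_mono (imp_refl _) h1) (imp_trans (uncurry (imp_refl _)) h2))

theorem and_intro {φ ψ χ : BFormula V} (h1 : Derivable Δ (imp χ φ)) (h2 : Derivable Δ (imp χ ψ)) :
    Derivable Δ (imp χ (and φ ψ)) := mp h2 (mp h1 (flew (.and_intro φ ψ χ)))

theorem or_elim {φ ψ χ : BFormula V} (h1 : Derivable Δ (imp φ χ)) (h2 : Derivable Δ (imp ψ χ)) :
    Derivable Δ (imp (or φ ψ) χ) := mp h2 (mp h1 (flew (.or_elim φ ψ χ)))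

theorem and_mono {φ φ' ψ ψ' : BFormula V} (h1 : Derivable Δ (imp φ φ'))
    (h2 : Derivable Δ (imp ψ ψ')) : Derivable Δ (imp (and φ ψ) (and φ' ψ')) :=
  and_intro (imp_trans (flew (.and_left _ _)) h1) (imp_trans (flew (.and_right _ _)) h2)

theorem or_mono {φ φ' ψ ψ' : BFormula V} (h1 : Derivable Δ (imp φ φ'))
    (h2 : Derivable Δ (imp ψ ψ')) : Derivable Δ (imp (or φ ψ) (or φ' ψ')) :=
  or_elim (imp_trans h1 (flew (.or_left _ _))) (imp_trans h2 (flew (.or_right _ _)))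

theorem box_mono {φ ψ : BFormula V} (h : Derivable Δ (imp φ ψ)) :
    Derivable Δ (imp (box φ) (box ψ)) := mp (nec h) (bax (.b4 φ ψ))

/-- Proof by cases. -/
theorem of_cases {φ ψ χ : BFormula V} (h : Derivable Δ (or φ ψ)) (h1 : Derivable Δ (imp φ χ))
    (h2 : Derivable Δ (imp ψ χ)) : Derivable Δ χ := mp h (or_elim h1 h2)

theorem efq (φ ψ : BFormula V) : Derivable Δ (imp (neg φ) (imp φ ψ)) :=
  imp_mono (imp_refl _) (flew (.zero_imp ψ))

/-- Necessitation and the third `B`-axiom give `Bφ ∨ ¬φ`; the second case contradicts `φ`. -/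
theorem imp_box_of_boolean {φ : BFormula V} (h : Derivable Δ (or φ (neg φ))) :
    Derivable Δ (imp φ (box φ)) :=
  of_cases (mp (nec h) (bax (.b3 φ))) (curry (flew (.fus_left _ _))) (efq _ _)

theorem imp_fus_self_of_boolean {φ : BFormula V} (h : Derivable Δ (or φ (neg φ))) :
    Derivable Δ (imp φ (fus φ φ)) :=
  of_cases h (curry (imp_refl _)) (efq _ _)

/-- `Bφ` is complemented. It is therefore idempotent, so modus ponens may use it twice, and it
implies `BBφ`, which handles necessitation. -/
theorem deduction {φ ψ : BFormula V} (h : Derivable (insert φ Δ) ψ) :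
    Derivable Δ (imp (box φ) ψ) := by
  induction h with
  | hyp h =>
    rcases h with rfl | h
    · exact bax (.b1 _)
    · exact weaken _ (hyp h)
  | flew h => exact weaken _ (flew h)
  | bax h => exact weaken _ (bax h)
  | mp _ _ h1 h2 =>
    exact imp_trans (imp_fus_self_of_boolean (bax (.b2 φ)))
      (uncurry (imp_trans h1 (exchange h2)))
  | nec _ h => exact imp_trans (imp_box_of_boolean (bax (.b2 φ))) (box_mono h)

theorem mono {Δ' : Set (BFormula V)} (hΔ : Δ ⊆ Δ') {φ : BFormula V} (h : Derivable Δ φ) :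
    Derivable Δ' φ := by
  induction h with
  | hyp h => exact hyp (hΔ h)
  | flew h => exact flew h
  | bax h => exact bax h
  | mp _ _ h1 h2 => exact mp h1 h2
  | nec _ h => exact nec h

/-- Derivations are finitary; this makes Zorn's lemma applicable to the sets not deriving `φ`. -/
theorem of_sUnion {c : Set (Set (BFormula V))} (hc : IsChain (· ⊆ ·) c) (hne : c.Nonempty)
    {φ : BFormula V} (h : Derivable (⋃₀ c) φ) : ∃ s ∈ c, Derivable s φ := by
  induction h with
  | hyp h => exact h.imp fun s hs => ⟨hs.1, hyp hs.2⟩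
  | flew h => exact hne.imp fun s hs => ⟨hs, flew h⟩
  | bax h => exact hne.imp fun s hs => ⟨hs, bax h⟩
  | mp _ _ h1 h2 =>
    obtain ⟨s, hs, h1⟩ := h1
    obtain ⟨t, ht, h2⟩ := h2
    rcases hc.total hs ht with hst | hst
    · exact ⟨t, ht, mp (h1.mono hst) h2⟩
    · exact ⟨s, hs, mp h1 (h2.mono hst)⟩
  | nec _ h => exact h.imp fun s hs => ⟨hs.1, nec hs.2⟩

end Derivable

open Derivable

variable (Δ) in
/-- Provable equivalence. -/
def provEquiv : Setoid (BFormula V) where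
  r φ ψ := Derivable Δ (imp φ ψ) ∧ Derivable Δ (imp ψ φ)
  iseqv := ⟨fun φ => ⟨imp_refl φ, imp_refl φ⟩, fun h => ⟨h.2, h.1⟩,
    fun h1 h2 => ⟨imp_trans h1.1 h2.1, imp_trans h2.2 h1.2⟩⟩

variable (Δ) in
/-- The Lindenbaum algebra of a theory. -/
def Lindenbaum : Type _ := Quotient (provEquiv Δ)

namespace Lindenbaum

variable (Δ) in
/-- The class of a formula. -/
def mk (φ : BFormula V) : Lindenbaum Δ := Quotient.mk _ φ

theorem ind {P : Lindenbaum Δ → Prop} (h : ∀ φ, P (mk Δ φ)) (a : Lindenbaum Δ) : P a :=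
  Quotient.ind h a

instance : PartialOrder (Lindenbaum Δ) where
  le := Quotient.lift₂ (fun φ ψ => Derivable Δ (imp φ ψ)) fun _ _ _ _ h1 h2 =>
    propext ⟨fun h => imp_trans (imp_trans h1.2 h) h2.1,
      fun h => imp_trans (imp_trans h1.1 h) h2.2⟩
  le_refl := ind imp_refl
  le_trans := ind fun _ => ind fun _ => ind fun _ => imp_trans
  le_antisymm := ind fun _ => ind fun _ h1 h2 => Quotient.sound ⟨h1, h2⟩

theorem mk_le_mk {φ ψ : BFormula V} : mk Δ φ ≤ mk Δ ψ ↔ Derivable Δ (imp φ ψ) := Iff.rfl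

instance : Lattice (Lindenbaum Δ) where
  sup := Quotient.map₂ or fun _ _ h1 _ _ h2 => ⟨or_mono h1.1 h2.1, or_mono h1.2 h2.2⟩
  inf := Quotient.map₂ and fun _ _ h1 _ _ h2 => ⟨and_mono h1.1 h2.1, and_mono h1.2 h2.2⟩
  le_sup_left := ind fun _ => ind fun _ => flew (.or_left _ _)
  le_sup_right := ind fun _ => ind fun _ => flew (.or_right _ _)
  sup_le := ind fun _ => ind fun _ => ind fun _ => or_elim
  inf_le_left := ind fun _ => ind fun _ => flew (.and_left _ _)
  inf_le_right := ind fun _ => ind fun _ => flew (.and_right _ _)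
  le_inf := ind fun _ => ind fun _ => ind fun _ => and_intro

instance : ResiduatedLattice (Lindenbaum Δ) where
  mul := Quotient.map₂ fus fun _ _ h1 _ _ h2 => ⟨fus_mono h1.1 h2.1, fus_mono h1.2 h2.2⟩
  one := mk Δ one
  zero := mk Δ zero
  mul_assoc := ind fun _ => ind fun _ => ind fun _ => Quotient.sound
    ⟨uncurry (uncurry (imp_trans (curry (imp_refl _)) (flew (.curry _ _ _)))),
      uncurry (imp_trans (curry (curry (imp_refl _))) (flew (.uncurry _ _ _)))⟩
  mul_comm := ind fun _ => ind fun _ => Quotient.sound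
    ⟨flew (.fus_comm _ _), flew (.fus_comm _ _)⟩
  one_mul := ind fun _ => Quotient.sound
    ⟨imp_trans (flew (.fus_comm _ _)) (flew (.fus_left _ _)), mp one_intro (curry (imp_refl _))⟩
  mul_one := ind fun _ => Quotient.sound
    ⟨flew (.fus_left _ _), mp one_intro (exchange (curry (imp_refl _)))⟩
  res := Quotient.map₂ imp fun _ _ h1 _ _ h2 => ⟨imp_mono h1.2 h2.1, imp_mono h1.1 h2.2⟩
  zero_le' := ind fun _ => flew (.zero_imp _)
  le_one' := ind fun _ => flew (.imp_one _)
  mul_le_iff_le_res := ind fun _ => ind fun _ => ind fun _ => ⟨curry, uncurry⟩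

theorem mk_eq_one_iff {φ : BFormula V} : mk Δ φ = 1 ↔ Derivable Δ φ :=
  ResiduatedLattice.one_le_iff.symm.trans ⟨fun h => mp one_intro (mk_le_mk.1 h),
    fun h => mk_le_mk.2 (weaken one h)⟩

theorem mk_sup_rneg_eq_one_iff {φ : BFormula V} :
    mk Δ φ ⊔ ResiduatedLattice.rneg (mk Δ φ) = 1 ↔ Derivable Δ (or φ (neg φ)) :=
  mk_eq_one_iff (φ := or φ (neg φ))

instance : RLBAlgebra (Lindenbaum Δ) where
  bop := Quotient.map box fun _ _ h => ⟨box_mono h.1, box_mono h.2⟩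
  bop_le := ind fun _ => bax (.b1 _)
  bop_sup_rneg := ind fun φ => mk_sup_rneg_eq_one_iff.2 (bax (.b2 φ))
  le_bop := ind fun _ => ind fun _ h1 h2 =>
    imp_trans (imp_box_of_boolean (mk_sup_rneg_eq_one_iff.1 h2)) (box_mono h1)

theorem eval_mk (φ : BFormula V) : eval (fun p => mk Δ (var p)) φ = mk Δ φ := by
  induction φ with
  | var | zero | one => rfl
  | and _ _ h1 h2 | or _ _ h1 h2 | fus _ _ h1 h2 | imp _ _ h1 h2 => rw [eval, h1, h2]; rfl
  | box _ h => rw [eval, h]; rfl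

/-- In the Lindenbaum algebra of a theory maximal among those not deriving `φ`, the only
complemented elements are `0` and `1`. -/
theorem eq_zero_or_eq_one_of_maximal {φ : BFormula V}
    (hΔ : Maximal (fun s => ¬ Derivable s φ) Δ) (a : Lindenbaum Δ)
    (ha : a ⊔ ResiduatedLattice.rneg a = 1) : a = 0 ∨ a = 1 := by
  -- By maximality, adding `ψ` either changes nothing or makes `φ` derivable.
  have key : ∀ ψ, Derivable Δ ψ ∨ Derivable Δ (imp (box ψ) φ) := by
    intro ψ
    by_cases h : Derivable (insert ψ Δ) φ
    · exact Or.inr (deduction h)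
    · exact Or.inl (hyp (hΔ.le_of_ge h (Set.subset_insert _ _) (Set.mem_insert _ _)))
  induction a using ind with
  | h ψ =>
    have hψ := mk_sup_rneg_eq_one_iff.1 ha
    rcases key ψ with h | h
    · exact Or.inr (mk_eq_one_iff.2 h)
    rcases key (neg ψ) with h' | h'
    · exact Or.inl (ResiduatedLattice.le_zero_iff.1 (mk_le_mk.2 h'))
    -- With neither `ψ` nor `¬ψ` derivable, both `Bψ` and `B¬ψ` imply `φ`. As `ψ` and `¬ψ` are
    -- complemented, each implies its own `B`, so cases on `ψ ∨ ¬ψ` would derive `φ`.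
    have hnn : Derivable Δ (or (neg ψ) (neg (neg ψ))) :=
      of_cases hψ (imp_trans (exchange (imp_refl (neg ψ))) (flew (.or_right _ _)))
        (flew (.or_left _ _))
    exact absurd (of_cases hψ (imp_trans (imp_box_of_boolean hψ) h)
      (imp_trans (imp_box_of_boolean hnn) h')) hΔ.prop

end Lindenbaum

theorem exists_maximal_not_derivable {Γ : Set (BFormula V)} {φ : BFormula V}
    (h : ¬ Derivable Γ φ) : ∃ Δ, Γ ⊆ Δ ∧ Maximal (fun s => ¬ Derivable s φ) Δ :=
  zorn_subset_nonempty {s | ¬ Derivable s φ} (fun c hc hchain hne =>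
    ⟨⋃₀ c, fun hd => by
      obtain ⟨s, hs, hd⟩ := of_sUnion hchain hne hd
      exact hc hs hd, fun _ => Set.subset_sUnion_of_mem⟩) Γ h

end BFormula

/-! ### The finite model property -/

theorem theorem4 {V : Type*} (Γ : Set (BFormula V)) (hΓ : Γ.Finite) (φ : BFormula V)
    (h : ¬ BFormula.Derivable Γ φ) :
    ∃ (A : Type) (_ : RLBAlgebra A) (_ : Finite A) (v : V → A),
      (∀ γ ∈ Γ, BFormula.eval v γ = 1) ∧ BFormula.eval v φ < 1 := by
  obtain ⟨Δ, hΓΔ, hΔ⟩ := BFormula.exists_maximal_not_derivable h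
  have hφ : BFormula.Lindenbaum.mk Δ φ ≠ 1 := fun h =>
    hΔ.prop (BFormula.Lindenbaum.mk_eq_one_iff.1 h)
  obtain ⟨D, hD, hfin, w, hw⟩ := BFormula.exists_finite_eval_eq_one_iff
    (BFormula.Lindenbaum.eq_zero_or_eq_one_of_maximal hΔ)
    (fun p => BFormula.Lindenbaum.mk Δ (.var p)) (insert φ Γ) (hΓ.insert φ)
  refine ⟨D, hD, hfin, w, fun γ hγ => ?_, ?_⟩
  · rw [hw γ (Or.inr hγ), BFormula.Lindenbaum.eval_mk, BFormula.Lindenbaum.mk_eq_one_iff]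
    exact .hyp (hΓΔ hγ)
  · refine lt_of_le_of_ne (ResiduatedLattice.le_one' _) fun h1 => hφ ?_
    rw [hw φ (Or.inl rfl), BFormula.Lindenbaum.eval_mk] at h1
    exact h1
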